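/- Equip $\mathbb Z^3\subset\mathbb R^3$ with the Euclidean dot product, length $\|\cdot\|$ and cross product $\times$. A subgroup $\Gamma\le\mathbb Z^3$ is called a cubic sublattice with edge length $\ell$ if it has a $\mathbb Z$-basis consisting of three pairwise orthogonal vectors, all of length $\ell$. An integer vector is divisible by an integer $k$ if it equals $k\mathbf u$ for some $\mathbf u\in\mathbb Z^3$, and it is primitive if no positive integer $k\neq 1$ divides it. Let $\mathbf v\in\mathbb Z^3$ and let $d$ be a positive integer such that $d^2$ divides $\|\mathbf v\|^2$. Then there exists a cubic sublattice of $\mathbb Z^3$ with edge length $d$ that contains $\mathbf v$. If moreover $\mathbf v$ is primitive, then there is exactly one cubic sublattice of $\mathbb Z^3$ with edge length $d$ that contains $\mathbf v$, and it is $$\Gamma(\mathbf v,d)=\{\mathbf a\in\mathbb Z^3 : \mathbf a\times\mathbf v\text{ is divisible by }d\text{ and }(\mathbf a\times\mathbf v)\times\mathbf v\text{ is divisible by }d^2\}.$$ -/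

import Mathlib

open scoped Matrix

namespace CubicLattice

/-- The Euclidean length of an integer vector. -/
noncomputable def length (a : Fin 3 → ℤ) : ℝ :=
  Real.sqrt ((a ⬝ᵥ a : ℤ) : ℝ)

/-- The vector `a` is divisible by the integer `k`: it is `k` times an integer vector. -/
def DivisibleBy (k : ℤ) (a : Fin 3 → ℤ) : Prop :=
  ∃ u : Fin 3 → ℤ, a = k • u

/-- A vector is primitive if no positive integer other than `1` divides it. -/
def IsPrimitive (a : Fin 3 → ℤ) : Prop :=
  ∀ k : ℤ, 0 < k → DivisibleBy k a → k = 1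

/-- `Γ` is a cubic sublattice of `ℤ³` with edge length `ℓ`: it has a `ℤ`-basis of three pairwise
orthogonal vectors, all of length `ℓ`. -/
def IsCubicSublattice (Γ : Submodule ℤ (Fin 3 → ℤ)) (ℓ : ℝ) : Prop :=
  ∃ b : Module.Basis (Fin 3) ℤ Γ,
    (∀ i j, i ≠ j → (b i : Fin 3 → ℤ) ⬝ᵥ (b j : Fin 3 → ℤ) = 0) ∧
    ∀ i, length (b i : Fin 3 → ℤ) = ℓ

/-- The lattice `Γ(v, d)` of all integer vectors `a` such that `a × v` is divisible by `d` and
`(a × v) × v` is divisible by `d ^ 2`. -/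
def gammaLattice (v : Fin 3 → ℤ) (d : ℤ) : Submodule ℤ (Fin 3 → ℤ) where
  carrier := {a | DivisibleBy d (a ⨯₃ v) ∧ DivisibleBy (d ^ 2) ((a ⨯₃ v) ⨯₃ v)}
  zero_mem' := ⟨⟨0, by simp⟩, ⟨0, by simp⟩⟩
  add_mem' := by
    rintro a b ⟨⟨x, hx⟩, ⟨y, hy⟩⟩ ⟨⟨z, hz⟩, ⟨w, hw⟩⟩
    refine ⟨⟨x + z, ?_⟩, ⟨y + w, ?_⟩⟩
    · rw [map_add, LinearMap.add_apply, hx, hz, smul_add]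
    · rw [map_add, LinearMap.add_apply, map_add, LinearMap.add_apply, hy, hw, smul_add]
  smul_mem' := by
    rintro c a ⟨⟨x, hx⟩, ⟨y, hy⟩⟩
    refine ⟨⟨c • x, ?_⟩, ⟨c • y, ?_⟩⟩
    · rw [map_smul, LinearMap.smul_apply, hx, smul_comm]
    · rw [map_smul, LinearMap.smul_apply, map_smul, LinearMap.smul_apply, hy, smul_comm]

end CubicLattice

/-!
Rescale the lattice `Γ(v, d)` to `L = Γ(v, d) / d ⊆ ℚ³`. If `v` is primitive, choose `u` with
`u ⬝ᵥ v = 1`; then the members of `Γ(v, d)` are exactly the vectors `s • v + d • x` with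
`d ∣ x ⬝ᵥ v` (`mem_gammaLattice_iff`). Direct computation from this description shows that dot
products on `L` are integers, that `L` is closed under the cross product, and that `L` is its own
dual.

Any lattice with these three properties has an orthonormal triple
(`exists_orthonormal_of_selfDual`). Let `a` be a shortest nonzero vector of `L` and `w = a × b` a
shortest nonzero vector of `a × L`, with squared lengths `n` and `W`. Reducing `b` modulo `a` and
comparing with `a` gives `3 n² ≤ 4 W`. By self-duality there is `c ∈ L` with `c ⬝ᵥ w = 1`; reducing
`a × c` modulo `w` and comparing with `w` gives `3 W² ≤ 4 n`. Hence `n = W = 1`, and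
`a, w, a × w` is the required triple. Scaling back by `d`, the lattice `Γ(v, d)` is cubic with edge
length `d`; the triple is a basis because coordinates with respect to it are dot products.

For uniqueness, a cubic sublattice `Γ` of edge length `d` is closed under `(x, y) ↦ (x × y) / d`,
because the cross product of two basis vectors is `± d` times the third. If `v ∈ Γ` this gives
`Γ ⊆ Γ(v, d)`, and integrality of the form on `Γ(v, d) / d` gives the reverse inclusion
(`IsCubicSublattice.eq_gammaLattice`). Existence for a vector that is not primitive follows by
scaling the lattice of its primitive part.
-/

namespace CubicLattice

/-! ### Self-dual lattices closed under the cross product -/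

theorem exists_min_dotProduct_self {S : Set (Fin 3 → ℚ)} (hS : S.Nonempty)
    (hint : ∀ x ∈ S, ∃ n : ℤ, x ⬝ᵥ x = n) : ∃ a ∈ S, ∀ b ∈ S, a ⬝ᵥ a ≤ b ⬝ᵥ b := by
  obtain ⟨a, ha, hmin⟩ :=
    (measure fun x : Fin 3 → ℚ => ⌊x ⬝ᵥ x⌋.toNat).wf.has_min S hS
  refine ⟨a, ha, fun b hb => ?_⟩
  have h : ⌊a ⬝ᵥ a⌋.toNat ≤ ⌊b ⬝ᵥ b⌋.toNat := not_lt.mp (hmin b hb)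
  obtain ⟨m, hm⟩ := hint a ha
  obtain ⟨n, hn⟩ := hint b hb
  have hn0 : (0 : ℚ) ≤ n := by rw [← hn]; exact Finset.sum_nonneg fun i _ => mul_self_nonneg (b i)
  have hn0' : 0 ≤ n := by exact_mod_cast hn0
  rw [hm, hn, Int.floor_intCast, Int.floor_intCast] at h
  rw [hm, hn]
  exact_mod_cast (by omega : m ≤ n)

/-- Evaluation against `w` maps `L` onto `gℤ` for some `g`, and `w / g` then pairs integrally with
all of `L`. -/
theorem exists_dotProduct_eq_and_inv_smul_mem {L : AddSubgroup (Fin 3 → ℚ)}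
    (hint : ∀ x ∈ L, ∀ y ∈ L, ∃ n : ℤ, x ⬝ᵥ y = n)
    (hdual : ∀ x, (∀ y ∈ L, ∃ n : ℤ, x ⬝ᵥ y = n) → x ∈ L)
    {w : Fin 3 → ℚ} (hw : w ∈ L) (hw0 : w ≠ 0) :
    ∃ g : ℤ, 0 < g ∧ (∃ c ∈ L, c ⬝ᵥ w = g) ∧ (g : ℚ)⁻¹ • w ∈ L := by
  let H : AddSubgroup ℤ :=
    { carrier := {n | ∃ c ∈ L, c ⬝ᵥ w = n}
      zero_mem' := ⟨0, L.zero_mem, by simp⟩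
      add_mem' := by
        rintro m n ⟨c, hc, hcm⟩ ⟨e, he, hen⟩
        exact ⟨c + e, L.add_mem hc he, by rw [add_dotProduct, hcm, hen]; push_cast; rfl⟩
      neg_mem' := by
        rintro m ⟨c, hc, hcm⟩
        exact ⟨-c, L.neg_mem hc, by rw [neg_dotProduct, hcm]; push_cast; rfl⟩ }
  obtain ⟨g, hg⟩ := Int.subgroup_cyclic H
  have hww : w ⬝ᵥ w ≠ 0 := fun h => hw0 (dotProduct_self_eq_zero.mp h)
  have hdvd : ∀ y ∈ L, ∃ k : ℤ, w ⬝ᵥ y = g * k := by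
    intro y hy
    obtain ⟨n, hn⟩ := hint y hy w hw
    have hmem : n ∈ H := ⟨y, hy, hn⟩
    rw [hg, AddSubgroup.mem_closure_singleton] at hmem
    obtain ⟨k, hk⟩ := hmem
    refine ⟨k, ?_⟩
    rw [dotProduct_comm, hn, ← hk]
    simp [mul_comm]
  have hg0 : g ≠ 0 := by
    rintro rfl
    obtain ⟨k, hk⟩ := hdvd w hw
    exact hww (by rw [hk]; simp)
  have hgQ : (|g| : ℚ) ≠ 0 := by simpa using hg0
  refine ⟨|g|, abs_pos.mpr hg0, ?_, ?_⟩
  · have hmem : |g| ∈ H := by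
      have hgH : g ∈ H := by rw [hg]; exact AddSubgroup.mem_closure_singleton_self g
      rcases abs_choice g with h | h <;> rw [h]
      exacts [hgH, H.neg_mem hgH]
    exact hmem
  · refine hdual _ fun y hy => ?_
    obtain ⟨k, hk⟩ := hdvd y hy
    rcases abs_choice g with h | h
    · refine ⟨k, ?_⟩
      have : (g : ℚ) ≠ 0 := by exact_mod_cast hg0
      rw [h, smul_dotProduct, hk, smul_eq_mul]; field_simp
    · refine ⟨-k, ?_⟩
      have : (g : ℚ) ≠ 0 := by exact_mod_cast hg0
      rw [h, smul_dotProduct, hk, smul_eq_mul]; push_cast; field_simp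

theorem exists_int_abs_sub_mul_le (r : ℚ) {s : ℚ} (hs : 0 < s) :
    ∃ t : ℤ, (r - t * s) ^ 2 ≤ s ^ 2 / 4 := by
  refine ⟨round (r / s), ?_⟩
  have h := abs_sub_round (r / s)
  have h2 : r - round (r / s) * s = (r / s - round (r / s)) * s := by field_simp
  rw [h2, mul_pow]
  have h3 : (r / s - round (r / s)) ^ 2 ≤ (1 / 2) ^ 2 := sq_le_sq' (abs_le.mp h).1 (abs_le.mp h).2
  nlinarith [sq_nonneg s]

theorem sub_intCast_smul_mem {L : AddSubgroup (Fin 3 → ℚ)} {x y : Fin 3 → ℚ} (hx : x ∈ L)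
    (hy : y ∈ L) (t : ℤ) : x - (t : ℚ) • y ∈ L := by
  rw [Int.cast_smul_eq_zsmul]
  exact L.sub_mem hx (L.zsmul_mem hy t)

theorem inv_sq_mul_lt {g : ℤ} (hg : 0 < g) (hg1 : g ≠ 1) {r : ℚ} (hr : 0 < r) :
    (g : ℚ)⁻¹ * ((g : ℚ)⁻¹ * r) < r := by
  have h2 : (2 : ℚ) ≤ g := by exact_mod_cast (by omega : 2 ≤ g)
  have h3 : (g : ℚ)⁻¹ ≤ 2⁻¹ := inv_anti₀ (by norm_num) h2
  have h4 : (0 : ℚ) < (g : ℚ)⁻¹ := by positivity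
  nlinarith [mul_pos h4 hr]

/-- Otherwise every `a × e` would pair to `0` with `L`, hence lie in `L`, and `a × (a × e)` would
vanish for all `e`. -/
theorem exists_cross_ne_zero {L : AddSubgroup (Fin 3 → ℚ)}
    (hdual : ∀ x, (∀ y ∈ L, ∃ n : ℤ, x ⬝ᵥ y = n) → x ∈ L)
    {a : Fin 3 → ℚ} (ha : a ≠ 0) : ∃ b ∈ L, a ⨯₃ b ≠ 0 := by
  by_contra! h
  have key : ∀ e, a ⨯₃ e = 0 := by
    intro e
    have hadj : ∀ y, (a ⨯₃ e) ⬝ᵥ y = -(e ⬝ᵥ (a ⨯₃ y)) := by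
      intro y
      simp [cross_apply, dotProduct, Fin.sum_univ_three]; ring
    have hmem : a ⨯₃ e ∈ L := hdual _ fun y hy => ⟨0, by rw [hadj, h y hy]; simp⟩
    refine dotProduct_self_eq_zero.mp ?_
    rw [hadj, h _ hmem]; simp
  have k0 := key ![1, 0, 0]
  have k1 := key ![0, 1, 0]
  simp [cross_apply] at k0 k1
  apply ha
  ext i; fin_cases i <;> simp [k0, k1]

/-- A lattice in `ℚ³` that is integral, self-dual and closed under the cross product contains an
orthonormal triple. -/
theorem exists_orthonormal_of_selfDual {L : AddSubgroup (Fin 3 → ℚ)}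
    (hint : ∀ x ∈ L, ∀ y ∈ L, ∃ n : ℤ, x ⬝ᵥ y = n)
    (hcross : ∀ x ∈ L, ∀ y ∈ L, x ⨯₃ y ∈ L)
    (hdual : ∀ x, (∀ y ∈ L, ∃ n : ℤ, x ⬝ᵥ y = n) → x ∈ L) :
    ∃ e : Fin 3 → Fin 3 → ℚ, (∀ i, e i ∈ L) ∧ (∀ i j, i ≠ j → e i ⬝ᵥ e j = 0) ∧
      ∀ i, e i ⬝ᵥ e i = 1 := by
  have hpos : ∀ x : Fin 3 → ℚ, x ≠ 0 → 0 < x ⬝ᵥ x := fun x hx =>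
    lt_of_le_of_ne (Finset.sum_nonneg fun i _ => mul_self_nonneg (x i)) fun h => hx (dotProduct_self_eq_zero.mp h.symm)
  -- `a` is a shortest nonzero vector of `L`.
  obtain ⟨a, ⟨haL, ha0⟩, hamin⟩ := exists_min_dotProduct_self (S := {x | x ∈ L ∧ x ≠ 0})
    (by
      by_contra hne
      have hzero : ∀ x ∈ L, x = 0 := fun x hx => by
        by_contra h0
        exact hne ⟨x, hx, h0⟩
      have h1 : (1 : Fin 3 → ℚ) ∈ L :=
        hdual _ fun y hy => ⟨0, by rw [hzero y hy]; simp⟩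
      exact one_ne_zero (hzero _ h1))
    (fun x hx => hint x hx.1 x hx.1)
  -- `w = a × b` is a shortest nonzero vector of `a × L`.
  obtain ⟨w, ⟨hw0, b, hbL, hw⟩, hwmin⟩ := exists_min_dotProduct_self
    (S := {x | x ≠ 0 ∧ ∃ b ∈ L, x = a ⨯₃ b})
    (by
      obtain ⟨b, hb, hab⟩ := exists_cross_ne_zero hdual ha0
      exact ⟨_, hab, b, hb, rfl⟩)
    (by
      rintro x ⟨-, b, hb, rfl⟩
      exact hint _ (hcross a haL b hb) _ (hcross a haL b hb))
  have hwL : w ∈ L := hw ▸ hcross a haL b hbL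
  have hn := hpos a ha0
  have hW := hpos w hw0
  have haw : a ⬝ᵥ w = 0 := by rw [hw]; exact dot_self_cross a b
  obtain ⟨n, hna⟩ := hint a haL a haL
  obtain ⟨W, hWw⟩ := hint w hwL w hwL
  -- Minimality of `a` makes it primitive in `L = L*`, so some `a'` pairs to `1` with it.
  obtain ⟨a', ha'L, haa'⟩ : ∃ a' ∈ L, a' ⬝ᵥ a = 1 := by
    obtain ⟨g, hg, ⟨c, hcL, hc⟩, hga⟩ := exists_dotProduct_eq_and_inv_smul_mem hint hdual haL ha0
    have hg1 : g = 1 := by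
      by_contra hg1
      have h := hamin _ ⟨hga, smul_ne_zero (by positivity) ha0⟩
      rw [smul_dotProduct, dotProduct_smul, smul_eq_mul, smul_eq_mul] at h
      exact absurd h (not_le.mpr (inv_sq_mul_lt hg hg1 hn))
    exact ⟨c, hcL, by rw [hc, hg1]; simp⟩
  -- Likewise for `w`: if `w / g ∈ L`, then `w / g = a × ((w / g) × a')` lies in `a × L`.
  obtain ⟨c, hcL, hcw⟩ : ∃ c ∈ L, c ⬝ᵥ w = 1 := by
    obtain ⟨g, hg, ⟨c, hcL, hc⟩, hgw⟩ := exists_dotProduct_eq_and_inv_smul_mem hint hdual hwL hw0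
    have hg1 : g = 1 := by
      by_contra hg1
      have hmem : (g : ℚ)⁻¹ • w = a ⨯₃ (((g : ℚ)⁻¹ • w) ⨯₃ a') := by
        have h1 : a ⨯₃ (w ⨯₃ a') = (a' ⬝ᵥ a) • w - (a ⬝ᵥ w) • a' := by
          ext i; fin_cases i <;> simp [cross_apply, dotProduct, Fin.sum_univ_three] <;> ring
        rw [map_smul, LinearMap.smul_apply, map_smul, h1, haa', haw]; simp
      have h := hwmin _ ⟨smul_ne_zero (by positivity) hw0, _, hcross _ hgw _ ha'L, hmem⟩
      rw [smul_dotProduct, dotProduct_smul, smul_eq_mul, smul_eq_mul] at h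
      exact absurd h (not_le.mpr (inv_sq_mul_lt hg hg1 hW))
    exact ⟨c, hcL, by rw [hc, hg1]; simp⟩
  -- Reducing `b` modulo `a` and comparing with `a`.
  have hineq1 : 3 * n ^ 2 ≤ 4 * W := by
    obtain ⟨t, ht⟩ := exists_int_abs_sub_mul_le (a ⬝ᵥ b) hn
    set b' := b - (t : ℚ) • a with hb'
    have hwb' : w = a ⨯₃ b' := by rw [hb', map_sub, map_smul, cross_self, hw]; simp
    have hb'0 : b' ≠ 0 := fun h => hw0 (by rw [hwb', h]; simp)
    have h1 := hamin b' ⟨sub_intCast_smul_mem hbL haL t, hb'0⟩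
    have h2 : w ⬝ᵥ w = (a ⬝ᵥ a) * (b' ⬝ᵥ b') - (a ⬝ᵥ b') ^ 2 := by
      rw [hwb', cross_dot_cross, dotProduct_comm b' a]; ring
    have h3 : a ⬝ᵥ b' = a ⬝ᵥ b - t * (a ⬝ᵥ a) := by
      rw [hb', dotProduct_sub, dotProduct_smul, smul_eq_mul]
    rw [← h3] at ht
    have h4 : 3 * (a ⬝ᵥ a) ^ 2 ≤ 4 * (w ⬝ᵥ w) := by nlinarith
    rw [hna, hWw] at h4
    exact_mod_cast h4
  -- Reducing `a × c` modulo `w` and comparing with `w`.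
  have hineq2 : 3 * W ^ 2 ≤ 4 * n := by
    obtain ⟨t, ht⟩ := exists_int_abs_sub_mul_le (w ⬝ᵥ (a ⨯₃ c)) hW
    set c' := c - (t : ℚ) • b with hc'
    have hc'w : c' ⬝ᵥ w = 1 := by
      rw [hc', sub_dotProduct, smul_dotProduct, hcw, hw, dot_cross_self]; simp
    have hac' : a ⨯₃ c' = a ⨯₃ c - (t : ℚ) • w := by rw [hc', map_sub, map_smul, hw]
    have hne : a ⨯₃ c' ≠ 0 := by
      intro h
      have h1 : c' ⬝ᵥ w = -(b ⬝ᵥ (a ⨯₃ c')) := by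
        rw [hw]; simp [cross_apply, dotProduct, Fin.sum_univ_three]; ring
      rw [hc'w, h] at h1
      simp at h1
    have h1 := hwmin _ ⟨hne, c', sub_intCast_smul_mem hcL hbL t, rfl⟩
    have h2 : w ⨯₃ (a ⨯₃ c') = a := by
      have h : w ⨯₃ (a ⨯₃ c') = (c' ⬝ᵥ w) • a - (a ⬝ᵥ w) • c' := by
        ext i; fin_cases i <;> simp [cross_apply, dotProduct, Fin.sum_univ_three] <;> ring
      rw [h, hc'w, haw]; simp
    have h3 : a ⬝ᵥ a = (w ⬝ᵥ w) * ((a ⨯₃ c') ⬝ᵥ (a ⨯₃ c')) - (w ⬝ᵥ (a ⨯₃ c')) ^ 2 := by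
      conv_lhs => rw [← h2]
      rw [cross_dot_cross, dotProduct_comm (a ⨯₃ c') w]; ring
    have h4 : w ⬝ᵥ (a ⨯₃ c') = w ⬝ᵥ (a ⨯₃ c) - t * (w ⬝ᵥ w) := by
      rw [hac', dotProduct_sub, dotProduct_smul, smul_eq_mul]
    rw [← h4] at ht
    have h5 : 3 * (w ⬝ᵥ w) ^ 2 ≤ 4 * (a ⬝ᵥ a) := by nlinarith
    rw [hna, hWw] at h5
    exact_mod_cast h5
  rw [hna] at hn
  rw [hWw] at hW
  have hn' : 0 < n := by exact_mod_cast hn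
  have hW' : 0 < W := by exact_mod_cast hW
  have hn1 : n = 1 := by
    have : n < 2 := by
      by_contra! h
      have hWn : 3 * n ≤ 2 * W := by nlinarith
      nlinarith
    omega
  have hW1 : W = 1 := by
    have : W < 2 := by
      by_contra! h
      nlinarith
    omega
  subst hn1 hW1
  have haaw : (a ⨯₃ w) ⬝ᵥ (a ⨯₃ w) = 1 := by
    rw [cross_dot_cross, hna, hWw, haw]; simp
  refine ⟨![a, w, a ⨯₃ w], ?_, ?_, ?_⟩
  · intro i; fin_cases i
    exacts [haL, hwL, hcross a haL w hwL]
  · intro i j hij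
    have hwa : w ⬝ᵥ a = 0 := by rw [dotProduct_comm, haw]
    have h1 := dot_self_cross a w
    have h2 := dot_cross_self a w
    fin_cases i <;> fin_cases j <;> first | exact absurd rfl hij | skip
    exacts [haw, h1, hwa, h2, (dotProduct_comm _ _).trans h1, (dotProduct_comm _ _).trans h2]
  · intro i; fin_cases i
    exacts [by simpa using hna, by simpa using hWw, haaw]

/-! ### Orthogonal triples of equal length -/

theorem length_eq_intCast_iff {d : ℤ} (hd : 0 < d) (a : Fin 3 → ℤ) :
    length a = (d : ℝ) ↔ a ⬝ᵥ a = d ^ 2 := by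
  have hd' : (0 : ℝ) < d := by exact_mod_cast hd
  rw [length, Real.sqrt_eq_iff_mul_self_eq_of_pos hd', ← pow_two]
  constructor <;> intro h
  · exact_mod_cast h.symm
  · exact_mod_cast h.symm

/-- Expansion in an orthogonal triple: a square matrix with `B Bᵀ = d²` also has `Bᵀ B = d²`. -/
theorem sq_smul_eq_sum {d : ℤ} (hd : d ≠ 0) {b : Fin 3 → Fin 3 → ℤ}
    (horth : ∀ i j, i ≠ j → b i ⬝ᵥ b j = 0) (hnorm : ∀ i, b i ⬝ᵥ b i = d ^ 2) (x : Fin 3 → ℤ) :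
    d ^ 2 • x = ∑ i, (x ⬝ᵥ b i) • b i := by
  have hM : Matrix.of b * (Matrix.of b)ᵀ = Matrix.diagonal fun _ => d ^ 2 := by
    ext i j
    rw [Matrix.mul_apply', Matrix.diagonal_apply]
    split_ifs with h
    · subst h; exact hnorm i
    · exact horth i j h
  have hdet : (Matrix.of b).det ≠ 0 := by
    intro h
    have h1 := congrArg Matrix.det hM
    rw [Matrix.det_mul, h, zero_mul, Matrix.det_diagonal] at h1
    exact Finset.prod_ne_zero_iff.mpr (fun _ _ => pow_ne_zero 2 hd) h1.symm
  refine sub_eq_zero.mp (Matrix.eq_zero_of_mulVec_eq_zero hdet ?_)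
  ext j
  change b j ⬝ᵥ (d ^ 2 • x - ∑ i, (x ⬝ᵥ b i) • b i) = 0
  rw [dotProduct_sub, dotProduct_smul, dotProduct_sum, Finset.sum_eq_single j]
  · rw [dotProduct_smul, hnorm, dotProduct_comm x, smul_eq_mul, smul_eq_mul]; ring
  · intro i _ hij
    rw [dotProduct_smul, horth j i hij.symm, smul_zero]
  · simp

/-- A cubic sublattice is characterised by an orthogonal triple of the right length such that the
coordinates `(x ⬝ᵥ b i) / d ^ 2` of its members are integers. -/
theorem isCubicSublattice_iff {d : ℤ} (hd : 0 < d) (Γ : Submodule ℤ (Fin 3 → ℤ)) :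
    IsCubicSublattice Γ (d : ℝ) ↔ ∃ b : Fin 3 → Fin 3 → ℤ, (∀ i, b i ∈ Γ) ∧
      (∀ i j, i ≠ j → b i ⬝ᵥ b j = 0) ∧ (∀ i, b i ⬝ᵥ b i = d ^ 2) ∧
      ∀ x ∈ Γ, ∀ i, d ^ 2 ∣ x ⬝ᵥ b i := by
  constructor
  · rintro ⟨b, horth, hlen⟩
    have hnorm := fun i => (length_eq_intCast_iff hd _).mp (hlen i)
    refine ⟨fun i => b i, fun i => (b i).2, horth, hnorm, fun x hx i => ?_⟩
    have hsum := congrArg (Γ.subtype) (b.sum_repr ⟨x, hx⟩)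
    rw [map_sum] at hsum
    simp only [map_smul, Submodule.subtype_apply] at hsum
    rw [← hsum, sum_dotProduct]
    refine Finset.dvd_sum fun j _ => ?_
    rw [smul_dotProduct, smul_eq_mul]
    rcases eq_or_ne j i with rfl | hji
    · rw [hnorm]; exact dvd_mul_left _ _
    · rw [horth j i hji, mul_zero]; exact dvd_zero _
  · rintro ⟨b, hb, horth, hnorm, hdvd⟩
    have hd2 : d ^ 2 ≠ 0 := pow_ne_zero 2 hd.ne'
    have hli : LinearIndependent ℤ fun i => (⟨b i, hb i⟩ : Γ) := by
      rw [Fintype.linearIndependent_iff]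
      intro g hg j
      have h1 := congrArg (Γ.subtype) hg
      simp only [map_sum, map_smul, Submodule.subtype_apply, map_zero] at h1
      have h2 := congrArg (fun y => y ⬝ᵥ b j) h1
      simp only [sum_dotProduct, smul_dotProduct, zero_dotProduct] at h2
      rw [Finset.sum_eq_single j (fun i _ hij => by rw [horth i j hij, smul_zero]) (by simp),
        hnorm, smul_eq_mul] at h2
      exact (mul_eq_zero.mp h2).resolve_right hd2
    have hspan : ⊤ ≤ Submodule.span ℤ (Set.range fun i => (⟨b i, hb i⟩ : Γ)) := by
      rintro ⟨x, hx⟩ -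
      choose c hc using hdvd x hx
      rw [Submodule.mem_span_range_iff_exists_fun]
      refine ⟨c, Subtype.ext (smul_right_injective _ hd2 ?_)⟩
      change d ^ 2 • (Γ.subtype (∑ i, c i • (⟨b i, hb i⟩ : Γ))) = d ^ 2 • x
      simp only [map_sum, map_smul, Submodule.subtype_apply]
      rw [sq_smul_eq_sum hd.ne' horth hnorm x, Finset.smul_sum]
      exact Finset.sum_congr rfl fun i _ => by rw [hc i, mul_smul]
    refine ⟨Module.Basis.mk hli hspan, fun i j hij => ?_, fun i => ?_⟩
    · simpa using horth i j hij
    · rw [length_eq_intCast_iff hd]; simpa using hnorm i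

/-- The multiple `gΓ` of a cubic sublattice is cubic. -/
theorem IsCubicSublattice.map_lsmul {d g : ℤ} (hd : 0 < d) (hg : 0 < g)
    {Γ : Submodule ℤ (Fin 3 → ℤ)} (h : IsCubicSublattice Γ (d : ℝ)) :
    IsCubicSublattice (Γ.map (LinearMap.lsmul ℤ (Fin 3 → ℤ) g)) ((g * d : ℤ) : ℝ) := by
  obtain ⟨b, hb, horth, hnorm, hdvd⟩ := (isCubicSublattice_iff hd Γ).mp h
  refine (isCubicSublattice_iff (mul_pos hg hd) _).mpr ⟨fun i => g • b i, fun i =>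
    Submodule.mem_map_of_mem (hb i), fun i j hij => ?_, fun i => ?_, ?_⟩
  · rw [smul_dotProduct, dotProduct_smul, horth i j hij, smul_zero, smul_zero]
  · rw [smul_dotProduct, dotProduct_smul, hnorm i, smul_eq_mul, smul_eq_mul]; ring
  · rintro _ ⟨x, hx, rfl⟩ i
    obtain ⟨k, hk⟩ := hdvd x hx i
    refine ⟨k, ?_⟩
    rw [LinearMap.lsmul_apply, smul_dotProduct, dotProduct_smul, hk, smul_eq_mul, smul_eq_mul]
    ring

/-- The sign is the orientation of the triple: its determinant `D` satisfies `D² = d⁶`. -/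
theorem cross_eq_or_eq_neg {d : ℤ} (hd : d ≠ 0) {p q r : Fin 3 → ℤ} (hpq : p ⬝ᵥ q = 0)
    (hqr : q ⬝ᵥ r = 0) (hrp : r ⬝ᵥ p = 0) (hp : p ⬝ᵥ p = d ^ 2) (hq : q ⬝ᵥ q = d ^ 2)
    (hr : r ⬝ᵥ r = d ^ 2) : p ⨯₃ q = d • r ∨ p ⨯₃ q = d • (-r) := by
  have hd2 : d ^ 2 ≠ 0 := pow_ne_zero 2 hd
  have hqp : q ⬝ᵥ p = 0 := by rw [dotProduct_comm, hpq]
  have hexp : d ^ 2 • (p ⨯₃ q) = ((p ⨯₃ q) ⬝ᵥ r) • r := by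
    rw [sq_smul_eq_sum hd (b := ![p, q, r]) ?_ ?_, Fin.sum_univ_three]
    · have h1 : (p ⨯₃ q) ⬝ᵥ p = 0 := by rw [dotProduct_comm, dot_self_cross]
      have h2 : (p ⨯₃ q) ⬝ᵥ q = 0 := by rw [dotProduct_comm, dot_cross_self]
      simp [h1, h2]
    · intro i j hij
      have hrq : r ⬝ᵥ q = 0 := by rw [dotProduct_comm, hqr]
      have hpr : p ⬝ᵥ r = 0 := by rw [dotProduct_comm, hrp]
      fin_cases i <;> fin_cases j <;> first | exact absurd rfl hij | skip
      exacts [hpq, hpr, hqp, hqr, hrp, hrq]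
    · intro i; fin_cases i
      exacts [hp, hq, hr]
  set D := (p ⨯₃ q) ⬝ᵥ r with hD
  have hsq : D ^ 2 = (d ^ 3) ^ 2 := by
    have h1 := congrArg (fun y => y ⬝ᵥ (p ⨯₃ q)) hexp
    simp only [smul_dotProduct, smul_eq_mul] at h1
    rw [cross_dot_cross, hp, hq, hpq, dotProduct_comm r, ← hD] at h1
    linear_combination -h1
  rcases sq_eq_sq_iff_eq_or_eq_neg.mp hsq with h | h
  · left
    refine smul_right_injective _ hd2 ?_
    change d ^ 2 • (p ⨯₃ q) = d ^ 2 • d • r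
    rw [hexp, h, smul_smul, pow_succ d 2]
  · right
    refine smul_right_injective _ hd2 ?_
    change d ^ 2 • (p ⨯₃ q) = d ^ 2 • d • (-r)
    rw [hexp, h, smul_smul, smul_neg, neg_smul, pow_succ d 2]

theorem IsCubicSublattice.exists_cross_eq_smul {d : ℤ} (hd : 0 < d)
    {Γ : Submodule ℤ (Fin 3 → ℤ)} (h : IsCubicSublattice Γ (d : ℝ)) {x y : Fin 3 → ℤ}
    (hx : x ∈ Γ) (hy : y ∈ Γ) : ∃ z ∈ Γ, x ⨯₃ y = d • z := by
  obtain ⟨b, horth, hlen⟩ := h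
  have hnorm := fun i => (length_eq_intCast_iff hd _).mp (hlen i)
  let N := Γ.map (LinearMap.lsmul ℤ (Fin 3 → ℤ) d)
  have hcyc : ∀ i j k : Fin 3, i ≠ j → j ≠ k → k ≠ i →
      (b i : Fin 3 → ℤ) ⨯₃ (b j : Fin 3 → ℤ) ∈ N := by
    intro i j k hij hjk hki
    rcases cross_eq_or_eq_neg hd.ne' (horth i j hij) (horth j k hjk) (horth k i hki) (hnorm i)
      (hnorm j) (hnorm k) with h | h
    · exact ⟨b k, (b k).2, h.symm⟩
    · exact ⟨-b k, Γ.neg_mem (b k).2, h.symm⟩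
  have hbb : ∀ i j, (b i : Fin 3 → ℤ) ⨯₃ (b j : Fin 3 → ℤ) ∈ N := by
    intro i j
    rcases eq_or_ne i j with rfl | hij
    · rw [cross_self]; exact N.zero_mem
    · obtain ⟨k, hjk, hki⟩ : ∃ k, j ≠ k ∧ k ≠ i := by revert i j; decide
      exact hcyc i j k hij hjk hki
  have hexp : ∀ z ∈ Γ, ∃ c : Fin 3 → ℤ, z = ∑ i, c i • (b i : Fin 3 → ℤ) := fun z hz =>
    ⟨b.repr ⟨z, hz⟩, by
      have hsum := congrArg Γ.subtype (b.sum_repr ⟨z, hz⟩).symm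
      rw [map_sum] at hsum
      simpa only [map_smul, Submodule.subtype_apply] using hsum⟩
  obtain ⟨s, rfl⟩ := hexp x hx
  obtain ⟨t, rfl⟩ := hexp y hy
  have hmem : (∑ i, s i • (b i : Fin 3 → ℤ)) ⨯₃ (∑ i, t i • (b i : Fin 3 → ℤ)) ∈ N := by
    simp only [map_sum, map_smul, LinearMap.sum_apply, LinearMap.smul_apply]
    exact N.sum_mem fun i _ => N.smul_mem _ (N.sum_mem fun j _ => N.smul_mem _ (hbb _ _))
  obtain ⟨z, hz, hzeq⟩ := hmem
  exact ⟨z, hz, hzeq.symm⟩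

/-! ### Primitive vectors -/

theorem IsPrimitive.exists_dotProduct_eq_one {v : Fin 3 → ℤ} (hv : IsPrimitive v) :
    ∃ u : Fin 3 → ℤ, u ⬝ᵥ v = 1 := by
  obtain ⟨g, hg⟩ := IsPrincipalIdealRing.principal (Ideal.span (Set.range v))
  have hdvd : ∀ i, g ∣ v i := fun i => by
    have h : v i ∈ Ideal.span (Set.range v) := Ideal.subset_span ⟨i, rfl⟩
    rw [hg] at h
    exact Ideal.mem_span_singleton.mp h
  choose w hw using hdvd
  have hg0 : g ≠ 0 := by
    rintro rfl
    have h := hv 2 two_pos ⟨0, by ext i; simp [hw i]⟩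
    omega
  have hgu : IsUnit g := by
    rw [Int.isUnit_iff_abs_eq]
    refine hv _ (abs_pos.mpr hg0) ⟨fun i => g.sign * w i, ?_⟩
    ext i
    simp only [Pi.smul_apply, smul_eq_mul]
    rw [hw i, ← mul_assoc, mul_comm |g|, Int.sign_mul_abs]
  have h1 : (1 : ℤ) ∈ Submodule.span ℤ (Set.range v) := by
    have htop : Ideal.span (Set.range v) = ⊤ := by
      rw [hg]; exact Ideal.span_singleton_eq_top.mpr hgu
    change (1 : ℤ) ∈ Ideal.span (Set.range v)
    rw [htop]; exact Submodule.mem_top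
  rw [Submodule.mem_span_range_iff_exists_fun] at h1
  exact h1

/-- This includes `v = 0`, where `k = 0`. -/
theorem exists_isPrimitive_smul_eq (v : Fin 3 → ℤ) :
    ∃ (k : ℤ) (w : Fin 3 → ℤ), IsPrimitive w ∧ v = k • w := by
  obtain ⟨w, hw, hgcd⟩ := Finset.extract_gcd v (Finset.univ_nonempty (α := Fin 3))
  refine ⟨Finset.univ.gcd v, w, ?_, by ext i; exact hw i (Finset.mem_univ i)⟩
  rintro m hm ⟨z, rfl⟩
  have h : m ∣ Finset.univ.gcd (m • z) := Finset.dvd_gcd fun i _ => ⟨z i, rfl⟩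
  rw [hgcd] at h
  exact Int.eq_one_of_dvd_one hm.le h

/-! ### The lattice `Γ(v, d)` -/

theorem mem_gammaLattice_iff {v u : Fin 3 → ℤ} {d : ℤ} (hd : d ≠ 0) (hv : d ^ 2 ∣ v ⬝ᵥ v)
    (hu : u ⬝ᵥ v = 1) (a : Fin 3 → ℤ) :
    a ∈ gammaLattice v d ↔ ∃ (s : ℤ) (x : Fin 3 → ℤ), a = s • v + d • x ∧ d ∣ x ⬝ᵥ v := by
  constructor
  · rintro ⟨⟨w, hw⟩, ⟨z, hz⟩⟩
    have ha : a = (a ⬝ᵥ u) • v + d • (u ⨯₃ w) := by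
      have h := cross_cross_eq_smul_sub_smul' u a v
      rw [hw, hu, map_smul, one_smul] at h
      rw [h]; abel
    refine ⟨a ⬝ᵥ u, u ⨯₃ w, ha, ?_⟩
    have h1 : a ⬝ᵥ v = (a ⬝ᵥ u) * (v ⬝ᵥ v) + d * ((u ⨯₃ w) ⬝ᵥ v) := by
      conv_lhs => rw [ha]
      rw [add_dotProduct, smul_dotProduct, smul_dotProduct, smul_eq_mul, smul_eq_mul]
    have h2 : a ⬝ᵥ v - (v ⬝ᵥ v) * (a ⬝ᵥ u) = d ^ 2 * (z ⬝ᵥ u) := by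
      have h := congrArg (fun y => y ⬝ᵥ u) hz
      simp only [cross_cross_eq_smul_sub_smul, sub_dotProduct, smul_dotProduct, smul_eq_mul] at h
      rwa [dotProduct_comm v u, hu, mul_one] at h
    refine ⟨z ⬝ᵥ u, mul_left_cancel₀ hd ?_⟩
    linear_combination h2 - h1
  · rintro ⟨s, x, rfl, t, ht⟩
    obtain ⟨m, hm⟩ := hv
    have hcr : (s • v + d • x) ⨯₃ v = d • (x ⨯₃ v) := by
      rw [map_add, map_smul, map_smul, LinearMap.add_apply, LinearMap.smul_apply,
        LinearMap.smul_apply, cross_self, smul_zero, zero_add]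
    refine ⟨⟨_, hcr⟩, ⟨t • v - (d * m) • x, ?_⟩⟩
    rw [hcr, map_smul, LinearMap.smul_apply, cross_cross_eq_smul_sub_smul, ht, hm]
    ext i
    simp only [Pi.smul_apply, Pi.sub_apply, smul_eq_mul]
    ring

theorem self_mem_gammaLattice (v : Fin 3 → ℤ) (d : ℤ) : v ∈ gammaLattice v d :=
  ⟨⟨0, by simp [cross_self]⟩, ⟨0, by simp [cross_self]⟩⟩

section

variable {v : Fin 3 → ℤ} {d : ℤ}

theorem sq_dvd_dotProduct_of_mem_gammaLattice (hd : d ≠ 0) (hv : d ^ 2 ∣ v ⬝ᵥ v)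
    (hp : IsPrimitive v) {a b : Fin 3 → ℤ} (ha : a ∈ gammaLattice v d)
    (hb : b ∈ gammaLattice v d) : d ^ 2 ∣ a ⬝ᵥ b := by
  obtain ⟨u, hu⟩ := hp.exists_dotProduct_eq_one
  obtain ⟨s, x, rfl, k, hx⟩ := (mem_gammaLattice_iff hd hv hu a).mp ha
  obtain ⟨t, y, rfl, l, hy⟩ := (mem_gammaLattice_iff hd hv hu b).mp hb
  obtain ⟨m, hm⟩ := hv
  refine ⟨s * t * m + s * l + t * k + x ⬝ᵥ y, ?_⟩
  simp only [add_dotProduct, dotProduct_add, smul_dotProduct, dotProduct_smul, smul_eq_mul]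
  rw [dotProduct_comm v y, hm, hx, hy]
  ring

theorem exists_cross_eq_smul_of_mem_gammaLattice (hd : d ≠ 0) (hv : d ^ 2 ∣ v ⬝ᵥ v)
    (hp : IsPrimitive v) {a b : Fin 3 → ℤ} (ha : a ∈ gammaLattice v d)
    (hb : b ∈ gammaLattice v d) : ∃ c ∈ gammaLattice v d, a ⨯₃ b = d • c := by
  obtain ⟨u, hu⟩ := hp.exists_dotProduct_eq_one
  obtain ⟨s, x, rfl, k, hx⟩ := (mem_gammaLattice_iff hd hv hu a).mp ha
  obtain ⟨t, y, rfl, l, hy⟩ := (mem_gammaLattice_iff hd hv hu b).mp hb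
  obtain ⟨m, hm⟩ := hv
  -- Modulo `d` both `x` and `y` are orthogonal to `v`, which makes `x × y` a multiple of `v`.
  obtain ⟨r, z, hz⟩ : ∃ (r : ℤ) (z : Fin 3 → ℤ), x ⨯₃ y = r • v + d • z := by
    refine ⟨(x ⨯₃ y) ⬝ᵥ u, u ⨯₃ (k • y - l • x), ?_⟩
    have h1 := cross_cross_eq_smul_sub_smul' u (x ⨯₃ y) v
    rw [hu, cross_cross_eq_smul_sub_smul, hx, hy, one_smul, mul_smul, mul_smul, ← smul_sub,
      map_smul] at h1
    rw [h1]; abel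
  refine ⟨s • (v ⨯₃ y) - t • (v ⨯₃ x) + d • (x ⨯₃ y), ⟨?_, ?_⟩, ?_⟩
  · refine ⟨s • (d * m) • y - s • l • v - t • (d * m) • x + t • k • v + (x ⨯₃ y) ⨯₃ v, ?_⟩
    simp only [map_add, map_sub, map_smul, LinearMap.add_apply, LinearMap.sub_apply,
      LinearMap.smul_apply]
    rw [cross_cross_eq_smul_sub_smul v y v, cross_cross_eq_smul_sub_smul v x v, hm, hx, hy]
    ext i
    simp only [Pi.smul_apply, Pi.sub_apply, Pi.add_apply, smul_eq_mul]
    ring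
  · set c := s • (v ⨯₃ y) - t • (v ⨯₃ x) + d • (x ⨯₃ y) with hc
    refine ⟨(d * r * m + z ⬝ᵥ v) • v - m • c, ?_⟩
    have hcv : c ⬝ᵥ v = d ^ 2 * (d * r * m + z ⬝ᵥ v) := by
      have h1 : (v ⨯₃ y) ⬝ᵥ v = 0 := by rw [dotProduct_comm, dot_self_cross]
      have h2 : (v ⨯₃ x) ⬝ᵥ v = 0 := by rw [dotProduct_comm, dot_self_cross]
      rw [hc, hz, add_dotProduct, sub_dotProduct]
      simp only [smul_dotProduct, add_dotProduct, smul_eq_mul]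
      rw [h1, h2, hm]; ring
    rw [cross_cross_eq_smul_sub_smul, hcv, hm, smul_sub, mul_smul, mul_smul]
  · simp only [map_add, map_smul, LinearMap.add_apply, LinearMap.smul_apply, cross_self]
    rw [← cross_anticomm v x]
    ext i
    simp only [Pi.smul_apply, Pi.sub_apply, Pi.add_apply, Pi.neg_apply, smul_eq_mul,
      Pi.zero_apply]
    ring

theorem sq_smul_mem_gammaLattice (x : Fin 3 → ℤ) : d ^ 2 • x ∈ gammaLattice v d := by
  refine ⟨⟨d • (x ⨯₃ v), ?_⟩, ⟨(x ⨯₃ v) ⨯₃ v, ?_⟩⟩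
  · rw [map_smul, LinearMap.smul_apply, smul_smul, pow_two]
  · simp only [map_smul, LinearMap.smul_apply]

/-- `Γ(v, d)` is its own dual with respect to the form `(a ⬝ᵥ b) / d ^ 2`. -/
theorem mem_gammaLattice_of_forall_sq_dvd (hd : d ≠ 0) (hv : d ^ 2 ∣ v ⬝ᵥ v)
    (hp : IsPrimitive v) {x : Fin 3 → ℤ} (hx : ∀ a ∈ gammaLattice v d, d ^ 2 ∣ x ⬝ᵥ a) :
    x ∈ gammaLattice v d := by
  obtain ⟨u, hu⟩ := hp.exists_dotProduct_eq_one
  obtain ⟨k, hk⟩ := hx v (self_mem_gammaLattice v d)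
  have hdvd : ∀ w : Fin 3 → ℤ, d ∣ (x ⨯₃ v) ⬝ᵥ w := by
    intro w
    obtain ⟨l, hl⟩ := hx (d • (v ⨯₃ w)) ((mem_gammaLattice_iff hd hv hu _).mpr
      ⟨0, v ⨯₃ w, by simp, by rw [dotProduct_comm, dot_self_cross]; exact dvd_zero d⟩)
    refine ⟨l, mul_left_cancel₀ hd ?_⟩
    have h1 : (x ⨯₃ v) ⬝ᵥ w = x ⬝ᵥ (v ⨯₃ w) := by
      simp [cross_apply, dotProduct, Fin.sum_univ_three]; ring
    rw [dotProduct_smul, smul_eq_mul] at hl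
    rw [h1, hl]; ring
  obtain ⟨m, hm⟩ := hv
  choose z hz using fun i => hdvd (Pi.single i 1)
  refine ⟨⟨z, ?_⟩, ⟨k • v - m • x, ?_⟩⟩
  · ext i
    have h := hz i
    rwa [dotProduct_single, mul_one] at h
  · rw [cross_cross_eq_smul_sub_smul, hk, hm, smul_sub, mul_smul, mul_smul]

theorem isCubicSublattice_gammaLattice (hd : 0 < d) (hv : d ^ 2 ∣ v ⬝ᵥ v) (hp : IsPrimitive v) :
    IsCubicSublattice (gammaLattice v d) (d : ℝ) := by
  have hd0 := hd.ne'
  have hdQ : (d : ℚ) ≠ 0 := by exact_mod_cast hd0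
  let ι : (Fin 3 → ℤ) → Fin 3 → ℚ := fun a i => a i
  have hιdot : ∀ a b, ι a ⬝ᵥ ι b = ((a ⬝ᵥ b : ℤ) : ℚ) := fun a b => by
    simp [ι, dotProduct]
  have hιcross : ∀ a b, ι a ⨯₃ ι b = ι (a ⨯₃ b) := fun a b => by
    ext i; fin_cases i <;> simp [ι, cross_apply]
  have hιsmul : ∀ (n : ℤ) a, ι (n • a) = (n : ℚ) • ι a := fun n a => by
    ext i; simp [ι]
  -- `L` is the lattice `Γ(v, d)` scaled down by `d`.
  let L : AddSubgroup (Fin 3 → ℚ) :=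
    { carrier := {x | ∃ a ∈ gammaLattice v d, (d : ℚ) • x = ι a}
      zero_mem' := ⟨0, Submodule.zero_mem _, by ext i; simp [ι]⟩
      add_mem' := by
        rintro x y ⟨a, ha, hxa⟩ ⟨b, hb, hyb⟩
        exact ⟨a + b, Submodule.add_mem _ ha hb, by
          rw [smul_add, hxa, hyb]; ext i; simp [ι]⟩
      neg_mem' := by
        rintro x ⟨a, ha, hxa⟩
        exact ⟨-a, Submodule.neg_mem _ ha, by rw [smul_neg, hxa]; ext i; simp [ι]⟩ }
  have hdot : ∀ {x y a b}, (d : ℚ) • x = ι a → (d : ℚ) • y = ι b →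
      (d : ℚ) ^ 2 * (x ⬝ᵥ y) = ((a ⬝ᵥ b : ℤ) : ℚ) := by
    intro x y a b hx hy
    rw [← hιdot, ← hx, ← hy, smul_dotProduct, dotProduct_smul, smul_eq_mul, smul_eq_mul]
    ring
  obtain ⟨e, heL, horth, hnorm⟩ := exists_orthonormal_of_selfDual (L := L)
    (by
      rintro x ⟨a, ha, hx⟩ y ⟨b, hb, hy⟩
      obtain ⟨k, hk⟩ := sq_dvd_dotProduct_of_mem_gammaLattice hd0 hv hp ha hb
      refine ⟨k, mul_left_cancel₀ (pow_ne_zero 2 hdQ) ?_⟩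
      rw [hdot hx hy, hk]; push_cast; rfl)
    (by
      rintro x ⟨a, ha, hx⟩ y ⟨b, hb, hy⟩
      obtain ⟨c, hc, habc⟩ := exists_cross_eq_smul_of_mem_gammaLattice hd0 hv hp ha hb
      refine ⟨c, hc, smul_right_injective _ hdQ ?_⟩
      change (d : ℚ) • (d : ℚ) • (x ⨯₃ y) = (d : ℚ) • ι c
      rw [← hιsmul, ← habc, ← hιcross, ← hx, ← hy, map_smul, map_smul, LinearMap.smul_apply])
    (by
      intro x hx
      have hint : ∀ i, ∃ n : ℤ, (d : ℚ) * x i = n := by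
        intro i
        obtain ⟨n, hn⟩ := hx ((d : ℚ) • ι (Pi.single i 1)) ⟨d ^ 2 • Pi.single i 1,
          sq_smul_mem_gammaLattice _, by rw [hιsmul, smul_smul]; push_cast; rw [pow_two]⟩
        refine ⟨n, ?_⟩
        have h1 : ι (Pi.single i 1) = Pi.single i 1 := by
          ext j; by_cases h : j = i
          · subst h; simp [ι]
          · simp [ι, h]
        rw [← hn, h1, dotProduct_smul, dotProduct_single, mul_one, smul_eq_mul]
      choose X hX using hint
      have hXx : (d : ℚ) • x = ι X := by ext i; exact hX i
      refine ⟨X, mem_gammaLattice_of_forall_sq_dvd hd0 hv hp fun a ha => ?_, hXx⟩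
      have hya : (d : ℚ) • (d : ℚ)⁻¹ • ι a = ι a := smul_inv_smul₀ hdQ _
      obtain ⟨n, hn⟩ := hx ((d : ℚ)⁻¹ • ι a) ⟨a, ha, hya⟩
      refine ⟨n, ?_⟩
      have h := hdot hXx hya
      rw [hn] at h
      exact_mod_cast h.symm)
  choose b hb heb using heL
  refine (isCubicSublattice_iff hd _).mpr ⟨b, hb, fun i j hij => ?_, fun i => ?_, fun x hx i =>
    sq_dvd_dotProduct_of_mem_gammaLattice hd0 hv hp hx (hb i)⟩
  · have h := hdot (heb i) (heb j)
    rw [horth i j hij, mul_zero] at h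
    exact_mod_cast h.symm
  · have h := hdot (heb i) (heb i)
    rw [hnorm i, mul_one] at h
    exact_mod_cast h.symm

/-- The containment `Γ ⊆ Γ(v, d)` holds because `Γ` is closed under `(x, y) ↦ (x × y) / d`; it is an
equality because coordinates with respect to a cubic basis of `Γ` are integral on `Γ(v, d)`. -/
theorem IsCubicSublattice.eq_gammaLattice (hd : 0 < d) (hv : d ^ 2 ∣ v ⬝ᵥ v)
    (hp : IsPrimitive v) {Γ : Submodule ℤ (Fin 3 → ℤ)} (h : IsCubicSublattice Γ (d : ℝ))
    (hvΓ : v ∈ Γ) : Γ = gammaLattice v d := by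
  have hle : Γ ≤ gammaLattice v d := by
    intro a ha
    obtain ⟨y, hy, hay⟩ := h.exists_cross_eq_smul hd ha hvΓ
    obtain ⟨z, -, hyz⟩ := h.exists_cross_eq_smul hd hy hvΓ
    exact ⟨⟨y, hay⟩, ⟨z, by rw [hay, map_smul, LinearMap.smul_apply, hyz, smul_smul, pow_two]⟩⟩
  refine le_antisymm hle fun x hx => ?_
  obtain ⟨b, hb, horth, hnorm, -⟩ := (isCubicSublattice_iff hd Γ).mp h
  choose c hc using fun i => sq_dvd_dotProduct_of_mem_gammaLattice hd.ne' hv hp hx (hle (hb i))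
  have hxc : x = ∑ i, c i • b i := by
    refine smul_right_injective _ (pow_ne_zero 2 hd.ne') ?_
    change d ^ 2 • x = d ^ 2 • ∑ i, c i • b i
    rw [sq_smul_eq_sum hd.ne' horth hnorm x, Finset.smul_sum]
    exact Finset.sum_congr rfl fun i _ => by rw [hc i, mul_smul]
  rw [hxc]
  exact Γ.sum_mem fun i _ => Γ.smul_mem _ (hb i)

end

/-- Write `v = k • w` with `w` primitive and let `g = gcd k d`; then `(d / g) ^ 2` divides
`w ⬝ᵥ w`, and `g` times `Γ(w, d / g)` contains `v`. -/
theorem exists_isCubicSublattice_mem {v : Fin 3 → ℤ} {d : ℤ} (hd : 0 < d)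
    (hv : d ^ 2 ∣ v ⬝ᵥ v) :
    ∃ Γ : Submodule ℤ (Fin 3 → ℤ), IsCubicSublattice Γ (d : ℝ) ∧ v ∈ Γ := by
  obtain ⟨k, w, hw, rfl⟩ := exists_isPrimitive_smul_eq v
  have hg : 0 < k.gcd d := Int.gcd_pos_of_ne_zero_right k hd.ne'
  obtain ⟨k', d', hcop, hk, hd'⟩ := Int.exists_gcd_one hg
  set g : ℤ := (k.gcd d : ℤ)
  have hg' : 0 < g := Int.natCast_pos.mpr hg
  have hd'pos : 0 < d' := pos_of_mul_pos_left (hd' ▸ hd) hg'.le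
  have hdvd : d' ^ 2 ∣ w ⬝ᵥ w := by
    have h1 : (d' * g) ^ 2 ∣ (k' * g) ^ 2 * (w ⬝ᵥ w) := by
      rw [← hk, ← hd']
      rw [smul_dotProduct, dotProduct_smul, smul_eq_mul, smul_eq_mul] at hv
      rwa [pow_two k, mul_assoc]
    have h2 : g ^ 2 * d' ^ 2 ∣ g ^ 2 * (k' ^ 2 * (w ⬝ᵥ w)) := by
      convert h1 using 1 <;> ring
    have h3 := (mul_dvd_mul_iff_left (pow_ne_zero 2 hg'.ne')).mp h2
    exact ((Int.isCoprime_iff_gcd_eq_one.mpr hcop).symm.pow (m := 2) (n := 2)).dvd_of_dvd_mul_left h3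
  refine ⟨(gammaLattice w d').map (LinearMap.lsmul ℤ (Fin 3 → ℤ) g), ?_, ?_⟩
  · rw [hd', mul_comm d' g]
    exact (isCubicSublattice_gammaLattice hd'pos hdvd hw).map_lsmul hd'pos hg'
  · refine ⟨k' • w, Submodule.smul_mem _ _ (self_mem_gammaLattice w d'), ?_⟩
    rw [LinearMap.lsmul_apply, smul_smul, mul_comm, ← hk]

end CubicLattice

theorem theorem1 (v : Fin 3 → ℤ) (d : ℤ) (hd : 0 < d) (hv : d ^ 2 ∣ v ⬝ᵥ v) :
    (∃ Γ : Submodule ℤ (Fin 3 → ℤ), CubicLattice.IsCubicSublattice Γ (d : ℝ) ∧ v ∈ Γ) ∧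
    (CubicLattice.IsPrimitive v →
      (∃! Γ : Submodule ℤ (Fin 3 → ℤ), CubicLattice.IsCubicSublattice Γ (d : ℝ) ∧ v ∈ Γ) ∧
      CubicLattice.IsCubicSublattice (CubicLattice.gammaLattice v d) (d : ℝ) ∧
      v ∈ CubicLattice.gammaLattice v d) := by
  refine ⟨CubicLattice.exists_isCubicSublattice_mem hd hv, fun hp => ?_⟩
  have hcubic := CubicLattice.isCubicSublattice_gammaLattice hd hv hp
  have hmem := CubicLattice.self_mem_gammaLattice v d
  exact ⟨⟨_, ⟨hcubic, hmem⟩, fun Γ hΓ => hΓ.1.eq_gammaLattice hd hv hp hΓ.2⟩, hcubic, hmem⟩
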